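/- Let $A_1,\dots,A_m$ be complex $n\times n$ matrices, let $Q$ be a (Hermitian) positive definite $n\times n$ matrix, and let $X$ be a positive definite solution of $$X-\sum_{i=1}^m A_i^*X^{-1}A_i=Q .$$ Let $\|\cdot\|$ be the spectral norm and $\mathcal H^{n\times n}$ the real space of Hermitian $n\times n$ matrices. Put $B_i=X^{-1}A_i$ and define $\mathbf L:\mathcal H^{n\times n}\to\mathcal H^{n\times n}$ by $\mathbf LW=W+\sum_{i=1}^m B_i^*WB_i$. Then $\mathbf L$ is invertible. Let $\mathbf P_iZ=\mathbf L^{-1}(B_i^*Z+Z^*B_i)$ for $Z\in\mathbb C^{n\times n}$, let $\|\mathbf L^{-1}\|$ and $\|\mathbf P_i\|$ be the operator norms induced by the spectral norm, and set $$l=\|\mathbf L^{-1}\|^{-1},\quad \zeta=\|X^{-1}\|,\quad \theta=\sum_{i=1}^m\|B_i\|^2 .$$ (a) Let $\Delta A_i\in\mathbb C^{n\times n}$ and $\Delta Q\in\mathcal H^{n\times n}$ be such that $\widetilde Q=Q+\Delta Q$ is positive definite, let $\widetilde A_i=A_i+\Delta A_i$, and let $\widetilde X$ be a positive definite solution of $\widetilde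 X-\sum_{i=1}^m\widetilde A_i^*\widetilde X^{-1}\widetilde A_i=\widetilde Q$. Put $$\epsilon=\frac1l\|\Delta Q\|+\sum_{i=1}^m\Big(\|\mathbf P_i\|\,\|\Delta A_i\|+\frac{\zeta}{l}\|\Delta A_i\|^2\Big),\qquad \sigma=\frac{\zeta}{l}\sum_{i=1}^m\big((\|A_i\|+\|\Delta A_i\|)\zeta+\|B_i\|\big)\|\Delta A_i\| .$$ If $$\sigma<1\quad\text{and}\quad \epsilon<\frac{l(1-\sigma)^2}{\zeta\big(l+l\sigma+2\theta+2\sqrt{(l\sigma+\theta)(\theta+l)}\big)},$$ then $$\|\widetilde X-X\|\le \xi_3:=\frac{2l\epsilon}{l(1+\zeta\epsilon-\sigma)+\sqrt{l^2(1+\zeta\epsilon-\sigma)^2-4l\zeta\epsilon(l+\theta)}},$$ and $\xi_3$ is the smallest real root of $\zeta(l+\theta)\xi^2-l(1+\zeta\epsilon-\sigma)\xi+l\epsilon=0$. (b) As $(\Delta A_1,\dots,\Delta A_m,\Delta Q)\to0$ with $\Delta A_i\in\mathbb C^{n\times n}$, $\Delta Q\in\mathcal H^{n\times n}$, the positive definite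 solution $\widetilde X$ of the perturbed equation satisfies $$\|\widetilde X-X\|\le\frac1l\|\Delta Q\|+\sum_{i=1}^m\|\mathbf P_i\|\,\|\Delta A_i\|+O\big(\|(\Delta A_1,\dots,\Delta A_m,\Delta Q)\|_F^2\big)$$ and $$\widetilde X-X=\mathbf L^{-1}\Delta Q+\mathbf L^{-1}\sum_{i=1}^m(B_i^*\Delta A_i+\Delta A_i^*B_i)+O\big(\|(\Delta A_1,\dots,\Delta A_m,\Delta Q)\|_F^2\big),$$ where $\|\cdot\|_F$ is the Frobenius norm and the constants in $O(\cdot)$ depend only on $A_1,\dots,A_m,Q,X$. -/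

import Mathlib

open scoped Matrix.Norms.L2Operator ComplexOrder Matrix

noncomputable section

namespace MatrixEq

/-- Complex `n × n` matrices; `‖·‖` on them is the spectral norm. -/
abbrev Mat (n : ℕ) : Type := Matrix (Fin n) (Fin n) ℂ

/-- The real normed space of Hermitian `n × n` matrices, with the spectral norm. -/
abbrev Herm (n : ℕ) : Type := selfAdjoint.submodule ℝ (Mat n)

/-- `X` is a positive definite solution of `X - ∑ Aᵢ* X⁻¹ Aᵢ = Q`. -/
def IsPosDefSolution {m n : ℕ} (A : Fin m → Mat n) (Q X : Mat n) : Prop :=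
  X.PosDef ∧ X - ∑ i, (A i)ᴴ * X⁻¹ * A i = Q

/-- `Bᵢ = X⁻¹ Aᵢ`. -/
def B {m n : ℕ} (A : Fin m → Mat n) (X : Mat n) (i : Fin m) : Mat n := X⁻¹ * A i

/-- The operator `L W = W + ∑ Bᵢ* W Bᵢ` on Hermitian matrices. -/
def L {m n : ℕ} (A : Fin m → Mat n) (X : Mat n) : Herm n →L[ℝ] Herm n :=
  LinearMap.toContinuousLinearMap
    { toFun := fun W => ⟨(W : Mat n) + ∑ i, (B A X i)ᴴ * (W : Mat n) * B A X i, by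
        have hW : (W : Mat n)ᴴ = W := W.2
        change _ᴴ = _
        simp [Matrix.conjTranspose_sum, Matrix.conjTranspose_mul, hW, Matrix.mul_assoc]⟩
      map_add' := fun V W => by
        apply Subtype.ext
        simp only [Submodule.coe_add, mul_add, add_mul, Finset.sum_add_distrib]
        abel
      map_smul' := fun c W => by
        apply Subtype.ext
        simp [Finset.smul_sum] }

/-- The inverse of `L`, as an operator on Hermitian matrices (that `L` is invertible is part of the
theorem). -/
def Linv {m n : ℕ} (A : Fin m → Mat n) (X : Mat n) : Herm n →L[ℝ] Herm n :=
  (L A X).inverse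

/-- The real-linear map `Z ↦ Bᵢ* Z + Z* Bᵢ` from complex matrices to Hermitian matrices. -/
def S {m n : ℕ} (A : Fin m → Mat n) (X : Mat n) (i : Fin m) : Mat n →L[ℝ] Herm n :=
  LinearMap.toContinuousLinearMap
    { toFun := fun Z => ⟨(B A X i)ᴴ * Z + Zᴴ * B A X i, by
        change _ᴴ = _
        simp [Matrix.conjTranspose_mul, add_comm]⟩
      map_add' := fun V W => by
        apply Subtype.ext
        simp only [Submodule.coe_add, mul_add, add_mul, Matrix.conjTranspose_add]
        abel
      map_smul' := fun c W => by
        apply Subtype.ext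
        simp [Matrix.conjTranspose_smul] }

/-- `Pᵢ Z = L⁻¹ (Bᵢ* Z + Z* Bᵢ)`. -/
def P {m n : ℕ} (A : Fin m → Mat n) (X : Mat n) (i : Fin m) : Mat n →L[ℝ] Herm n :=
  (Linv A X).comp (S A X i)

/-- `l = ‖L⁻¹‖⁻¹`, with the operator norm induced by the spectral norm. -/
def ell {m n : ℕ} (A : Fin m → Mat n) (X : Mat n) : ℝ := ‖Linv A X‖⁻¹

/-- `ζ = ‖X⁻¹‖`. -/
def zeta {n : ℕ} (X : Mat n) : ℝ := ‖X⁻¹‖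

/-- `θ = ∑ ‖Bᵢ‖²`. -/
def theta {m n : ℕ} (A : Fin m → Mat n) (X : Mat n) : ℝ := ∑ i, ‖B A X i‖ ^ 2

/-- `ε = ‖ΔQ‖ / l + ∑ (‖Pᵢ‖ ‖ΔAᵢ‖ + (ζ / l) ‖ΔAᵢ‖²)`. -/
def eps {m n : ℕ} (A : Fin m → Mat n) (X : Mat n) (ΔA : Fin m → Mat n) (ΔQ : Herm n) : ℝ :=
  1 / ell A X * ‖ΔQ‖ +
    ∑ i, (‖P A X i‖ * ‖ΔA i‖ + zeta X / ell A X * ‖ΔA i‖ ^ 2)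

/-- `σ = (ζ / l) ∑ ((‖Aᵢ‖ + ‖ΔAᵢ‖) ζ + ‖Bᵢ‖) ‖ΔAᵢ‖`. -/
def sigma {m n : ℕ} (A : Fin m → Mat n) (X : Mat n) (ΔA : Fin m → Mat n) : ℝ :=
  zeta X / ell A X * ∑ i, ((‖A i‖ + ‖ΔA i‖) * zeta X + ‖B A X i‖) * ‖ΔA i‖

/-- The bound `ξ₃`, as a function of `l, ζ, θ, σ, ε`. -/
def xi3 (l ζ θ σ ε : ℝ) : ℝ :=
  2 * l * ε /
    (l * (1 + ζ * ε - σ) + √(l ^ 2 * (1 + ζ * ε - σ) ^ 2 - 4 * l * ζ * ε * (l + θ)))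

/-- The Frobenius norm of the block matrix `(ΔA₁, …, ΔAₘ, ΔQ)`. -/
def pertNorm {m n : ℕ} (ΔA : Fin m → Mat n) (ΔQ : Herm n) : ℝ :=
  √((∑ k, ∑ i, ∑ j, ‖ΔA k i j‖ ^ 2) + ∑ i, ∑ j, ‖(ΔQ : Mat n) i j‖ ^ 2)

end MatrixEq

end

/-!
Uniqueness of the positive definite solution and injectivity of `L` both come from order
contraction. Since `Q` is positive definite, `X - Q ≤ k X` for some `k < 1`; inversion is antitone,
so for two solutions `X ≤ (1 + t) Y` gives `Y ≤ (1 + k t) X`, and iterating this in both directions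
drives `t` to `0`. Likewise `∑ Bᵢ* X Bᵢ = X - Q ≤ k X`, which forces `W = 0` whenever
`W = -∑ Bᵢ* W Bᵢ`.

The matrix `X + H` solves the perturbed equation iff `H` is a fixed point of
`H ↦ L⁻¹ (ΔQ + ∑ (Bᵢ* ΔAᵢ + ΔAᵢ* Bᵢ) + R H)`, where `R H` gathers the terms of higher order. With
`r = (1 - ζ ξ)⁻¹` bounding the growth of `X⁻¹ M` when `X` moves by at most `ξ`, on the ball of
radius `ξ` the remainder satisfies `‖R H - R 0‖ ≤ (θ (r - 1) + r l σ) ‖H‖` and is Lipschitz with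
constant `θ (r² - 1) + r² l σ`. Hence the ball is mapped to itself once
`ζ (l + θ) ξ² - l (1 + ζ ε - σ) ξ + l ε ≤ 0`, and the smaller root `ξ₃` makes the map a contraction
because it lies strictly to the left of the vertex. The fixed point yields a solution within `ξ₃` of
`X`, which by uniqueness is the given one. For small perturbations of size `p` the same argument
with a radius of order `p` gives `‖H‖ = O(p)`, and then `R H = O(p²)`.
-/

noncomputable section

namespace MatrixEq

open scoped Ring

lemma zero_mem_of_mul_mem {s : Set ℝ} (hs : IsClosed s) {k t : ℝ} (hk₀ : 0 ≤ k) (hk₁ : k < 1)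
    (ht₀ : 0 ≤ t) (ht : t ∈ s) (h : ∀ r ∈ s, 0 ≤ r → k * r ∈ s) : 0 ∈ s := by
  have hmem : ∀ j : ℕ, k ^ j * t ∈ s := fun j => by
    induction j with
    | zero => simpa using ht
    | succ j ih => simpa [pow_succ', mul_assoc] using h _ ih (by positivity)
  have hlim : Filter.Tendsto (fun j : ℕ => k ^ j * t) Filter.atTop (nhds 0) := by
    simpa using (tendsto_pow_atTop_nhds_zero_of_lt_one hk₀ hk₁).mul_const t
  exact hs.mem_of_tendsto hlim (Filter.Eventually.of_forall hmem)

section CStarAlgebra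

variable {𝒜 : Type*} [CStarAlgebra 𝒜] [PartialOrder 𝒜] [StarOrderedRing 𝒜]
  {ι : Type*} [Fintype ι]

lemma inverse_le_smul_inverse {x y : 𝒜} {t : ℝ} (ht : 0 < t) (hx : IsStrictlyPositive x)
    (h : x ≤ t • y) : y⁻¹ʳ ≤ t • x⁻¹ʳ := by
  have hpos : IsStrictlyPositive (t⁻¹ • x) := hx.smul (inv_pos.2 ht)
  have hinv : (t⁻¹ • x)⁻¹ʳ = t • x⁻¹ʳ := by
    rw [← mul_one (t⁻¹ • x)⁻¹ʳ, Ring.inverse_mul_eq_iff_eq_mul _ _ _ hpos.isUnit,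
      smul_mul_smul_comm, inv_mul_cancel₀ ht.ne', Ring.mul_inverse_cancel _ hx.isUnit, one_smul]
  exact (CStarAlgebra.ringInverse_le_ringInverse ((inv_smul_le_iff_of_pos ht).2 h) hpos).trans_eq
    hinv

lemma one_le_norm_inverse_smul {q : 𝒜} (hq : IsStrictlyPositive q) : 1 ≤ ‖q⁻¹ʳ‖ • q := by
  nontriviality 𝒜
  have h : q⁻¹ʳ ≤ ‖q⁻¹ʳ‖ • (1 : 𝒜) := by
    simpa only [Algebra.algebraMap_eq_smul_one] using
      IsSelfAdjoint.le_algebraMap_norm_self (ha := hq.ringInverse.isSelfAdjoint)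
  simpa only [Ring.inverse_one, Ring.inverse_inverse hq.isUnit] using
    inverse_le_smul_inverse (norm_pos_iff.2 hq.isUnit.ringInverse.ne_zero) hq.ringInverse h

lemma le_norm_mul_norm_inverse_smul {a q : 𝒜} (ha : IsSelfAdjoint a)
    (hq : IsStrictlyPositive q) : a ≤ (‖a‖ * ‖q⁻¹ʳ‖) • q :=
  calc a ≤ ‖a‖ • (1 : 𝒜) := by
        simpa only [Algebra.algebraMap_eq_smul_one] using
          IsSelfAdjoint.le_algebraMap_norm_self (ha := ha)
    _ ≤ ‖a‖ • ‖q⁻¹ʳ‖ • q := by gcongr; exact one_le_norm_inverse_smul hq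
    _ = _ := smul_smul _ _ _

lemma isStrictlyPositive_add_of_norm_lt {x h : 𝒜} (hx : IsStrictlyPositive x)
    (hh : IsSelfAdjoint h) (hlt : ‖x⁻¹ʳ‖ * ‖h‖ < 1) : IsStrictlyPositive (x + h) := by
  have hle := le_norm_mul_norm_inverse_smul hh.neg hx
  rw [norm_neg, mul_comm] at hle
  refine (hx.smul (sub_pos.2 hlt)).of_le ?_
  rwa [sub_smul, one_smul, sub_eq_add_neg, add_le_add_iff_left, neg_le]

lemma exists_sub_le_smul {x q : 𝒜} (hx : IsSelfAdjoint x) (hq : IsStrictlyPositive q) :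
    ∃ k : ℝ, 0 ≤ k ∧ k < 1 ∧ x - q ≤ k • x := by
  set c := ‖x‖ * ‖q⁻¹ʳ‖ + 1 with hc
  have hc₁ : 1 ≤ c := by simp only [hc, le_add_iff_nonneg_left]; positivity
  have hxc : x ≤ c • q := (le_norm_mul_norm_inverse_smul hx hq).trans
    (smul_le_smul_of_nonneg_right (by simp [hc]) hq.nonneg)
  refine ⟨1 - c⁻¹, sub_nonneg.2 (inv_le_one_of_one_le₀ hc₁), sub_lt_self _ (by positivity), ?_⟩
  have hcq : c⁻¹ • x ≤ q := (inv_smul_le_iff_of_pos (by positivity)).2 hxc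
  rw [sub_smul, one_smul]
  gcongr

lemma sum_conj_le_smul_sum_conj (b : ι → 𝒜) {t : ℝ} {u v : 𝒜} (h : u ≤ t • v) :
    ∑ i, star (b i) * u * b i ≤ t • ∑ i, star (b i) * v * b i :=
  calc ∑ i, star (b i) * u * b i ≤ ∑ i, star (b i) * (t • v) * b i :=
        Finset.sum_le_sum fun i _ => star_left_conjugate_le_conjugate h (b i)
    _ = t • ∑ i, star (b i) * v * b i := by
        simp only [mul_smul_comm, smul_mul_assoc, Finset.smul_sum]

lemma nonpos_of_add_sum_conj_eq_zero {b : ι → 𝒜} {w x : 𝒜} (hx : IsStrictlyPositive x)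
    (hb : IsStrictlyPositive (x - ∑ i, star (b i) * x * b i)) (hw : IsSelfAdjoint w)
    (h : w + ∑ i, star (b i) * w * b i = 0) : w ≤ 0 := by
  obtain ⟨k, hk₀, hk₁, hk⟩ := exists_sub_le_smul hx.isSelfAdjoint hb
  rw [sub_sub_cancel] at hk
  have hcontr : ∀ v t, 0 ≤ t → v ≤ t • x → ∑ i, star (b i) * v * b i ≤ (k * t) • x :=
    fun v t ht hv => calc
      ∑ i, star (b i) * v * b i ≤ t • ∑ i, star (b i) * x * b i :=
        sum_conj_le_smul_sum_conj b hv
      _ ≤ t • k • x := by gcongr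
      _ = (k * t) • x := by rw [smul_smul, mul_comm]
  -- Since `-∑ bᵢ* · bᵢ` fixes `w`, a bound `w ≤ t x` gives `-w ≤ k t x` and then `w ≤ k² t x`.
  have hneg : ∑ i, star (b i) * w * b i = -w := (neg_eq_of_add_eq_zero_right h).symm
  have hpos : ∑ i, star (b i) * -w * b i = w := by
    simp only [mul_neg, neg_mul, Finset.sum_neg_distrib, hneg, neg_neg]
  have hzero : (0 : ℝ) ∈ {t : ℝ | w ≤ t • x} :=
    zero_mem_of_mul_mem (isClosed_le continuous_const (by fun_prop))
      (mul_nonneg hk₀ hk₀) (mul_lt_one_of_nonneg_of_lt_one_left hk₀ hk₁ hk₁.le)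
      (by positivity) (le_norm_mul_norm_inverse_smul hw hx) fun t ht ht₀ => by
        have h₁ : -w ≤ (k * t) • x := hneg ▸ hcontr w t ht₀ ht
        have h₂ := hcontr (-w) (k * t) (by positivity) h₁
        rwa [hpos, ← mul_assoc] at h₂
  simpa using hzero

lemma eq_zero_of_add_sum_conj_eq_zero {b : ι → 𝒜} {w x : 𝒜} (hx : IsStrictlyPositive x)
    (hb : IsStrictlyPositive (x - ∑ i, star (b i) * x * b i)) (hw : IsSelfAdjoint w)
    (h : w + ∑ i, star (b i) * w * b i = 0) : w = 0 := by
  refine le_antisymm (nonpos_of_add_sum_conj_eq_zero hx hb hw h)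
    (neg_nonpos.1 (nonpos_of_add_sum_conj_eq_zero hx hb hw.neg ?_))
  simp only [mul_neg, neg_mul, Finset.sum_neg_distrib, ← neg_add, h, neg_zero]

lemma le_one_add_mul_smul {a : ι → 𝒜} {q x y : 𝒜} {k t : ℝ} (hx : IsStrictlyPositive x)
    (hxa : x - ∑ i, star (a i) * x⁻¹ʳ * a i = q) (hya : y - ∑ i, star (a i) * y⁻¹ʳ * a i = q)
    (hk : x - q ≤ k • x) (ht : 0 ≤ t) (h : x ≤ (1 + t) • y) : y ≤ (1 + k * t) • x := by
  have hsum : y - q ≤ (1 + t) • (x - q) :=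
    calc y - q = ∑ i, star (a i) * y⁻¹ʳ * a i := by rw [← hya, sub_sub_cancel]
      _ ≤ (1 + t) • ∑ i, star (a i) * x⁻¹ʳ * a i :=
          sum_conj_le_smul_sum_conj a (inverse_le_smul_inverse (by positivity) hx h)
      _ = (1 + t) • (x - q) := by rw [← hxa, sub_sub_cancel]
  calc y ≤ q + (1 + t) • (x - q) := sub_le_iff_le_add'.1 hsum
    _ = x + t • (x - q) := by module
    _ ≤ x + t • k • x := by gcongr
    _ = (1 + k * t) • x := by module

lemma le_of_sub_sum_conj_inverse_eq {a : ι → 𝒜} {q x y : 𝒜} (hq : IsStrictlyPositive q)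
    (hx : IsStrictlyPositive x) (hy : IsStrictlyPositive y)
    (hxa : x - ∑ i, star (a i) * x⁻¹ʳ * a i = q) (hya : y - ∑ i, star (a i) * y⁻¹ʳ * a i = q) :
    x ≤ y := by
  obtain ⟨k, hk₀, hk₁, hk⟩ := exists_sub_le_smul hx.isSelfAdjoint hq
  obtain ⟨k', hk₀', hk₁', hk'⟩ := exists_sub_le_smul hy.isSelfAdjoint hq
  have hzero : (0 : ℝ) ∈ {t : ℝ | x ≤ (1 + t) • y} := by
    refine zero_mem_of_mul_mem (t := ‖x‖ * ‖y⁻¹ʳ‖) (isClosed_le continuous_const (by fun_prop))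
      (mul_nonneg hk₀' hk₀) (mul_lt_one_of_nonneg_of_lt_one_left hk₀' hk₁' hk₁.le)
      (by positivity) ?_ fun t ht ht₀ => ?_
    · refine (le_norm_mul_norm_inverse_smul hx.isSelfAdjoint hy).trans
        (smul_le_smul_of_nonneg_right ?_ hy.nonneg)
      exact le_add_of_nonneg_left zero_le_one
    · have h := le_one_add_mul_smul hx hxa hya hk ht₀ ht
      rw [Set.mem_ofPred_eq, mul_assoc]
      exact le_one_add_mul_smul hy hya hxa hk' (by positivity) h
  simpa using hzero

lemma eq_of_sub_sum_conj_inverse_eq {a : ι → 𝒜} {q x y : 𝒜} (hq : IsStrictlyPositive q)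
    (hx : IsStrictlyPositive x) (hy : IsStrictlyPositive y)
    (hxa : x - ∑ i, star (a i) * x⁻¹ʳ * a i = q) (hya : y - ∑ i, star (a i) * y⁻¹ʳ * a i = q) :
    x = y :=
  le_antisymm (le_of_sub_sum_conj_inverse_eq hq hx hy hxa hya)
    (le_of_sub_sum_conj_inverse_eq hq hy hx hya hxa)

end CStarAlgebra

section NormedSpace

variable {E : Type*} [SeminormedAddCommGroup E] {b c : E} {k : ℝ}

lemma norm_le_inv_one_sub_mul (hk : k < 1) (h : ‖b - c‖ ≤ k * ‖c‖) :
    ‖c‖ ≤ (1 - k)⁻¹ * ‖b‖ := by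
  rw [inv_mul_eq_div, le_div_iff₀ (sub_pos.2 hk)]
  linarith [norm_le_norm_add_norm_sub b c]

lemma norm_sub_le_inv_one_sub_sub_one_mul (hk₀ : 0 ≤ k) (hk : k < 1) (h : ‖b - c‖ ≤ k * ‖c‖) :
    ‖b - c‖ ≤ ((1 - k)⁻¹ - 1) * ‖b‖ := by
  have hinv : k * (1 - k)⁻¹ = (1 - k)⁻¹ - 1 := by
    have : 1 - k ≠ 0 := (sub_pos.2 hk).ne'
    field_simp
    ring
  calc ‖b - c‖ ≤ k * ((1 - k)⁻¹ * ‖b‖) := h.trans (by gcongr; exact norm_le_inv_one_sub_mul hk h)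
    _ = ((1 - k)⁻¹ - 1) * ‖b‖ := by rw [← mul_assoc, hinv]

end NormedSpace

section NormedStarRing

variable {R : Type*} [NormedRing R] [StarRing R] [NormedStarGroup R]

lemma norm_star_mul_mul_le (u w v : R) : ‖star u * w * v‖ ≤ ‖w‖ * (‖u‖ * ‖v‖) :=
  calc ‖star u * w * v‖ ≤ ‖star u‖ * ‖w‖ * ‖v‖ := norm_mul₃_le
    _ = ‖w‖ * (‖u‖ * ‖v‖) := by rw [norm_star]; ring

lemma norm_star_mul_mul_sub_le (b u₁ u₂ v₁ v₂ w : R) :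
    ‖star b * w * b - star (u₁ + u₂) * w * (v₁ + v₂)‖ ≤
      ‖w‖ * (‖b‖ * ‖b - v₁‖ + ‖b - u₁‖ * ‖v₁‖ + ‖u₂‖ * ‖v₁ + v₂‖ + ‖u₁‖ * ‖v₂‖) := by
  have hsplit : star b * w * b - star (u₁ + u₂) * w * (v₁ + v₂) =
      star b * w * (b - v₁) + star (b - u₁) * w * v₁ - star u₂ * w * (v₁ + v₂)
        - star u₁ * w * v₂ := by
    rw [star_add, star_sub]
    noncomm_ring
  rw [hsplit]
  calc _ ≤ ‖w‖ * (‖b‖ * ‖b - v₁‖) + ‖w‖ * (‖b - u₁‖ * ‖v₁‖) + ‖w‖ * (‖u₂‖ * ‖v₁ + v₂‖)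
        + ‖w‖ * (‖u₁‖ * ‖v₂‖) := by
        refine norm_sub_le_of_le (norm_sub_le_of_le (norm_add_le_of_le ?_ ?_) ?_) ?_ <;>
          exact norm_star_mul_mul_le _ _ _
    _ = _ := by ring

lemma norm_star_mul_mul_sub_le_of_le {b u₁ u₂ v₁ v₂ w : R} {r s α δ : ℝ} (hr : 0 ≤ r)
    (hu₁ : ‖u₁‖ ≤ r * ‖b‖) (hv₁ : ‖v₁‖ ≤ s * ‖b‖) (hbu : ‖b - u₁‖ ≤ (r - 1) * ‖b‖)
    (hbv : ‖b - v₁‖ ≤ (s - 1) * ‖b‖) (hu₂ : ‖u₂‖ ≤ r * δ) (hv₂ : ‖v₂‖ ≤ s * δ)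
    (hv : ‖v₁ + v₂‖ ≤ s * α) :
    ‖star b * w * b - star (u₁ + u₂) * w * (v₁ + v₂)‖ ≤
      ‖w‖ * (‖b‖ ^ 2 * (r * s - 1) + r * s * ((α + ‖b‖) * δ)) := by
  refine (norm_star_mul_mul_sub_le b u₁ u₂ v₁ v₂ w).trans ?_
  calc ‖w‖ * (‖b‖ * ‖b - v₁‖ + ‖b - u₁‖ * ‖v₁‖ + ‖u₂‖ * ‖v₁ + v₂‖ + ‖u₁‖ * ‖v₂‖)
    _ ≤ ‖w‖ * (‖b‖ * ((s - 1) * ‖b‖) + (r - 1) * ‖b‖ * (s * ‖b‖) + r * δ * (s * α)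
        + r * ‖b‖ * (s * δ)) := by
      have := (norm_nonneg _).trans hbu
      have := (norm_nonneg _).trans hu₂
      gcongr
    _ = ‖w‖ * (‖b‖ ^ 2 * (r * s - 1) + r * s * ((α + ‖b‖) * δ)) := by ring

end NormedStarRing

section Solution

open scoped MatrixOrder

variable {m n : ℕ} {A : Fin m → Mat n} {Q X Y H : Mat n}

lemma posDef_add_of_norm_lt (hX : X.PosDef) (hH : H.IsHermitian) (h : ‖X⁻¹‖ * ‖H‖ < 1) :
    (X + H).PosDef := by
  rw [Matrix.nonsing_inv_eq_ringInverse] at h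
  exact Matrix.isStrictlyPositive_iff_posDef.1
    (isStrictlyPositive_add_of_norm_lt hX.isStrictlyPositive hH h)

theorem IsPosDefSolution.unique (hQ : Q.PosDef) (hX : IsPosDefSolution A Q X)
    (hY : IsPosDefSolution A Q Y) : X = Y :=
  eq_of_sub_sum_conj_inverse_eq hQ.isStrictlyPositive hX.1.isStrictlyPositive
    hY.1.isStrictlyPositive
    (by simpa only [Matrix.nonsing_inv_eq_ringInverse, Matrix.star_eq_conjTranspose] using hX.2)
    (by simpa only [Matrix.nonsing_inv_eq_ringInverse, Matrix.star_eq_conjTranspose] using hY.2)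

lemma IsPosDefSolution.sub_sum_conj_B (hX : IsPosDefSolution A Q X) :
    X - ∑ i, (B A X i)ᴴ * X * B A X i = Q := by
  have hdet := X.isUnit_iff_isUnit_det.1 hX.1.isUnit
  simpa only [B, Matrix.conjTranspose_mul, hX.1.inv.isHermitian.eq,
    Matrix.nonsing_inv_mul_cancel_right _ _ hdet, Matrix.mul_assoc] using hX.2

theorem IsPosDefSolution.isInvertible_L (hQ : Q.PosDef) (hX : IsPosDefSolution A Q X) :
    (L A X).IsInvertible := by
  have hinj : Function.Injective (L A X).toLinearMap := by
    rw [injective_iff_map_eq_zero]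
    intro W hW
    refine Subtype.ext (eq_zero_of_add_sum_conj_eq_zero hX.1.isStrictlyPositive ?_ W.2
      (congrArg Subtype.val hW))
    exact (hX.sub_sum_conj_B.symm ▸ hQ).isStrictlyPositive
  exact ⟨(LinearEquiv.ofInjectiveEndo _ hinj).toContinuousLinearEquiv, rfl⟩

end Solution

section NeumannBound

variable {n : ℕ} {X H K : Mat n} {x y : ℝ}

/-- The factor `(1 - ζ x)⁻¹` by which `‖X⁻¹ M‖` can grow when `X` is replaced by `X + H` with
`‖H‖ ≤ x`; meaningful only for `ζ x < 1`. -/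
def neumannBound (X : Mat n) (x : ℝ) : ℝ := (1 - zeta X * x)⁻¹

lemma neumannBound_zero (X : Mat n) : neumannBound X 0 = 1 := by simp [neumannBound]

lemma zeta_nonneg (X : Mat n) : 0 ≤ zeta X := norm_nonneg _

lemma one_le_neumannBound (hx₀ : 0 ≤ x) (hx : zeta X * x < 1) : 1 ≤ neumannBound X x :=
  (one_le_inv₀ (sub_pos.2 hx)).2 (sub_le_self _ (mul_nonneg (zeta_nonneg X) hx₀))

lemma norm_inv_mul_le (X M : Mat n) : ‖X⁻¹ * M‖ ≤ zeta X * ‖M‖ := norm_mul_le _ _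

lemma norm_inv_mul_sub_le_zeta_mul (hX : IsUnit X) (hXH : IsUnit (X + H)) (hH : ‖H‖ ≤ x)
    (M : Mat n) : ‖X⁻¹ * M - (X + H)⁻¹ * M‖ ≤ zeta X * x * ‖(X + H)⁻¹ * M‖ := by
  have hdiff : X⁻¹ * M - (X + H)⁻¹ * M = X⁻¹ * (H * ((X + H)⁻¹ * M)) := by
    rw [← sub_mul, Matrix.inv_sub_inv (iff_of_true hX hXH), add_sub_cancel_left]
    simp only [mul_assoc]
  rw [hdiff, mul_assoc]
  have := zeta_nonneg X
  exact (norm_inv_mul_le X _).trans (by gcongr; exact (norm_mul_le _ _).trans (by gcongr))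

lemma norm_add_inv_mul_le (hX : IsUnit X) (hXH : IsUnit (X + H)) (hH : ‖H‖ ≤ x)
    (hx : zeta X * x < 1) (M : Mat n) : ‖(X + H)⁻¹ * M‖ ≤ neumannBound X x * ‖X⁻¹ * M‖ :=
  norm_le_inv_one_sub_mul hx (norm_inv_mul_sub_le_zeta_mul hX hXH hH M)

lemma norm_inv_mul_sub_le (hX : IsUnit X) (hXH : IsUnit (X + H)) (hH : ‖H‖ ≤ x)
    (hx : zeta X * x < 1) (M : Mat n) :
    ‖X⁻¹ * M - (X + H)⁻¹ * M‖ ≤ (neumannBound X x - 1) * ‖X⁻¹ * M‖ :=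
  norm_sub_le_inv_one_sub_sub_one_mul
    (mul_nonneg (zeta_nonneg X) ((norm_nonneg _).trans hH)) hx
    (norm_inv_mul_sub_le_zeta_mul hX hXH hH M)

lemma conj_inv_sub_inv_eq (hXH : (X + H).PosDef) (hXK : (X + K).PosDef) (C : Mat n) :
    Cᴴ * ((X + H)⁻¹ - (X + K)⁻¹) * C = -(((X + H)⁻¹ * C)ᴴ * (H - K) * ((X + K)⁻¹ * C)) := by
  rw [Matrix.inv_sub_inv (iff_of_true hXH.isUnit hXK.isUnit), Matrix.conjTranspose_mul,
    hXH.inv.isHermitian.eq]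
  noncomm_ring

lemma norm_conj_add_conj_inv_sub_inv_le (hX : X.PosDef) (hH : H.IsHermitian)
    (hK : K.IsHermitian) (hHx : ‖H‖ ≤ x) (hx : zeta X * x < 1) (hKy : ‖K‖ ≤ y)
    (hy : zeta X * y < 1) (a d : Mat n) :
    ‖(X⁻¹ * a)ᴴ * (H - K) * (X⁻¹ * a) + (a + d)ᴴ * ((X + H)⁻¹ - (X + K)⁻¹) * (a + d)‖ ≤
      ‖H - K‖ * (‖X⁻¹ * a‖ ^ 2 * (neumannBound X x * neumannBound X y - 1) +
        neumannBound X x * neumannBound X y *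
          ((zeta X * (‖a‖ + ‖d‖) + ‖X⁻¹ * a‖) * (zeta X * ‖d‖))) := by
  have hζ := zeta_nonneg X
  have hXH := posDef_add_of_norm_lt hX hH ((mul_le_mul_of_nonneg_left hHx hζ).trans_lt hx)
  have hXK := posDef_add_of_norm_lt hX hK ((mul_le_mul_of_nonneg_left hKy hζ).trans_lt hy)
  have hr : 0 ≤ neumannBound X x := inv_nonneg.2 (sub_pos.2 hx).le
  have hs : 0 ≤ neumannBound X y := inv_nonneg.2 (sub_pos.2 hy).le
  have hHmul := norm_add_inv_mul_le hX.isUnit hXH.isUnit hHx hx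
  have hKmul := norm_add_inv_mul_le hX.isUnit hXK.isUnit hKy hy
  rw [conj_inv_sub_inv_eq hXH hXK, ← sub_eq_add_neg, mul_add _ a d, mul_add _ a d]
  refine norm_star_mul_mul_sub_le_of_le hr (hHmul a) (hKmul a)
    (norm_inv_mul_sub_le hX.isUnit hXH.isUnit hHx hx a)
    (norm_inv_mul_sub_le hX.isUnit hXK.isUnit hKy hy a)
    ((hHmul d).trans ?_) ((hKmul d).trans ?_) ?_
  · gcongr
    exact norm_inv_mul_le X d
  · gcongr
    exact norm_inv_mul_le X d
  · rw [← mul_add]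
    refine (hKmul (a + d)).trans ?_
    gcongr
    exact (norm_inv_mul_le X _).trans (by gcongr; exact norm_add_le a d)

end NeumannBound

section Remainder

variable {m n : ℕ} {A : Fin m → Mat n} {Q X : Mat n}

lemma coe_L (A : Fin m → Mat n) (X : Mat n) (W : Herm n) :
    (L A X W : Mat n) = W + ∑ i, (B A X i)ᴴ * (W : Mat n) * B A X i := rfl

lemma coe_S (A : Fin m → Mat n) (X : Mat n) (i : Fin m) (Z : Mat n) :
    (S A X i Z : Mat n) = (B A X i)ᴴ * Z + Zᴴ * B A X i := rfl

/-- The second order part of the perturbed equation: `X + H` solves the equation perturbed by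
`D` and `ΔQ` iff `L H = ΔQ + ∑ (Bᵢ* Dᵢ + Dᵢ* Bᵢ) + remainder`. -/
def remainder (A : Fin m → Mat n) {X : Mat n} (hX : X.IsHermitian) (D : Fin m → Mat n)
    (H : Herm n) : Herm n :=
  ⟨∑ i, ((D i)ᴴ * X⁻¹ * D i + ((B A X i)ᴴ * (H : Mat n) * B A X i +
      (A i + D i)ᴴ * ((X + (H : Mat n))⁻¹ - X⁻¹) * (A i + D i))), by
    have hH : (H : Mat n).IsHermitian := H.2
    refine isSelfAdjoint_sum _ fun i _ => ?_
    exact (Matrix.isHermitian_conjTranspose_mul_mul _ hX.inv).add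
      ((Matrix.isHermitian_conjTranspose_mul_mul _ hH).add
        (Matrix.isHermitian_conjTranspose_mul_mul _ ((hX.add hH).inv.sub hX.inv)))⟩

/-- `τ = l σ`, free of division. -/
def tau (A : Fin m → Mat n) (X : Mat n) (D : Fin m → Mat n) : ℝ :=
  zeta X * ∑ i, ((‖A i‖ + ‖D i‖) * zeta X + ‖B A X i‖) * ‖D i‖

/-- A Lipschitz constant of `remainder A hX D`, where `ρ` bounds the product of the growth
factors `neumannBound` at the two arguments. -/
def remainderLip (A : Fin m → Mat n) (X : Mat n) (D : Fin m → Mat n) (ρ : ℝ) : ℝ :=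
  theta A X * (ρ - 1) + ρ * tau A X D

lemma theta_nonneg (A : Fin m → Mat n) (X : Mat n) : 0 ≤ theta A X :=
  Finset.sum_nonneg fun _ _ => by positivity

lemma tau_nonneg (A : Fin m → Mat n) (X : Mat n) (D : Fin m → Mat n) : 0 ≤ tau A X D := by
  have := zeta_nonneg X
  exact mul_nonneg this (Finset.sum_nonneg fun _ _ => by positivity)

lemma remainderLip_nonneg (A : Fin m → Mat n) (X : Mat n) (D : Fin m → Mat n) {ρ : ℝ}
    (hρ : 1 ≤ ρ) : 0 ≤ remainderLip A X D ρ :=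
  add_nonneg (mul_nonneg (theta_nonneg A X) (sub_nonneg.2 hρ))
    (mul_nonneg (zero_le_one.trans hρ) (tau_nonneg A X D))

lemma sum_remainderLip_terms (A : Fin m → Mat n) (X : Mat n) (D : Fin m → Mat n) (ρ : ℝ) :
    ∑ i, (‖B A X i‖ ^ 2 * (ρ - 1) +
      ρ * ((zeta X * (‖A i‖ + ‖D i‖) + ‖B A X i‖) * (zeta X * ‖D i‖))) =
      remainderLip A X D ρ := by
  simp only [remainderLip, theta, tau, Finset.sum_add_distrib, Finset.sum_mul, Finset.mul_sum]
  congr 1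
  exact Finset.sum_congr rfl fun i _ => by ring

lemma coe_remainder_sub (hX : X.IsHermitian) (D : Fin m → Mat n) (H K : Herm n) :
    ((remainder A hX D H - remainder A hX D K : Herm n) : Mat n) =
      ∑ i, ((X⁻¹ * A i)ᴴ * ((H : Mat n) - K) * (X⁻¹ * A i) +
        (A i + D i)ᴴ * ((X + (H : Mat n))⁻¹ - (X + (K : Mat n))⁻¹) * (A i + D i)) := by
  simp only [remainder, AddSubgroupClass.coe_sub, ← Finset.sum_sub_distrib, B]
  exact Finset.sum_congr rfl fun i _ => by noncomm_ring

lemma norm_remainder_sub_le (A : Fin m → Mat n) (hX : X.PosDef) (D : Fin m → Mat n)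
    {H K : Herm n} {x y : ℝ} (hHx : ‖H‖ ≤ x) (hx : zeta X * x < 1) (hKy : ‖K‖ ≤ y)
    (hy : zeta X * y < 1) :
    ‖remainder A hX.isHermitian D H - remainder A hX.isHermitian D K‖ ≤
      remainderLip A X D (neumannBound X x * neumannBound X y) * ‖H - K‖ := by
  rw [← Submodule.norm_coe, coe_remainder_sub, ← sum_remainderLip_terms, mul_comm,
    Finset.mul_sum]
  exact norm_sum_le_of_le _ fun i _ =>
    norm_conj_add_conj_inv_sub_inv_le hX H.2 K.2 hHx hx hKy hy (A i) (D i)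

lemma norm_remainder_zero_le (A : Fin m → Mat n) (hX : X.IsHermitian) (D : Fin m → Mat n) :
    ‖remainder A hX D 0‖ ≤ ∑ i, zeta X * ‖D i‖ ^ 2 := by
  have hcoe : ((remainder A hX D 0 : Herm n) : Mat n) = ∑ i, (D i)ᴴ * X⁻¹ * D i := by
    simp [remainder]
  rw [← Submodule.norm_coe, hcoe]
  refine norm_sum_le_of_le _ fun i _ => (norm_star_mul_mul_le _ _ _).trans_eq ?_
  rw [zeta, sq]

lemma norm_remainder_le (A : Fin m → Mat n) (hX : X.PosDef) (D : Fin m → Mat n) {H : Herm n}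
    {x : ℝ} (hHx : ‖H‖ ≤ x) (hx : zeta X * x < 1) :
    ‖remainder A hX.isHermitian D H‖ ≤
      ∑ i, zeta X * ‖D i‖ ^ 2 + remainderLip A X D (neumannBound X x) * x := by
  have hx₀ : 0 ≤ x := (norm_nonneg _).trans hHx
  have hlip := norm_remainder_sub_le A hX D hHx hx (K := 0) (y := 0) (by simp) (by simp)
  rw [neumannBound_zero, mul_one, sub_zero] at hlip
  refine (norm_le_norm_add_norm_sub' _ _).trans
    (add_le_add (norm_remainder_zero_le A hX.isHermitian D) (hlip.trans ?_))
  have := remainderLip_nonneg A X D (one_le_neumannBound hx₀ hx)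
  gcongr

lemma coe_L_sub_remainder (hX : IsPosDefSolution A Q X) (D : Fin m → Mat n) (ΔQ H : Herm n) :
    ((L A X H - (ΔQ + ∑ i, S A X i (D i) + remainder A hX.1.isHermitian D H) : Herm n)
      : Mat n) =
      X + (H : Mat n) - ∑ i, (A i + D i)ᴴ * (X + (H : Mat n))⁻¹ * (A i + D i) - (Q + ΔQ) := by
  have hterm : ∀ i, (A i)ᴴ * X⁻¹ * A i - (A i + D i)ᴴ * (X + (H : Mat n))⁻¹ * (A i + D i) =
      (B A X i)ᴴ * (H : Mat n) * B A X i - ((B A X i)ᴴ * D i + (D i)ᴴ * B A X i) -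
        ((D i)ᴴ * X⁻¹ * D i + ((B A X i)ᴴ * (H : Mat n) * B A X i +
          (A i + D i)ᴴ * ((X + (H : Mat n))⁻¹ - X⁻¹) * (A i + D i))) := fun i => by
    simp only [B, Matrix.conjTranspose_mul, Matrix.conjTranspose_add, hX.1.inv.isHermitian.eq]
    noncomm_ring
  have hsum := Finset.sum_congr (rfl : Finset.univ = Finset.univ) fun i _ => hterm i
  simp only [Finset.sum_sub_distrib] at hsum
  simp only [AddSubgroupClass.coe_sub, Submodule.coe_add, Submodule.coe_sum, coe_L, coe_S,
    remainder]
  rw [← hX.2, eq_comm, ← sub_eq_zero, ← sub_eq_zero.2 hsum]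
  abel

lemma perturbed_equation_iff (hX : IsPosDefSolution A Q X) (D : Fin m → Mat n)
    (ΔQ H : Herm n) :
    X + (H : Mat n) - ∑ i, (A i + D i)ᴴ * (X + (H : Mat n))⁻¹ * (A i + D i) = Q + ΔQ ↔
      L A X H = ΔQ + ∑ i, S A X i (D i) + remainder A hX.1.isHermitian D H := by
  rw [← sub_eq_zero, ← coe_L_sub_remainder hX, Submodule.coe_eq_zero, sub_eq_zero]

end Remainder

section Scalar

lemma isLeast_smaller_root {a b c : ℝ} (ha : 0 < a) (hb : 0 < b) (hD : 0 < b ^ 2 - 4 * a * c) :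
    IsLeast {ξ : ℝ | a * ξ ^ 2 - b * ξ + c = 0} (2 * c / (b + √(b ^ 2 - 4 * a * c))) ∧
      2 * a * (2 * c / (b + √(b ^ 2 - 4 * a * c))) < b := by
  have hsq : √(b ^ 2 - 4 * a * c) ^ 2 = b ^ 2 - 4 * a * c := Real.sq_sqrt hD.le
  have hs : 0 < √(b ^ 2 - 4 * a * c) := Real.sqrt_pos.2 hD
  set s := √(b ^ 2 - 4 * a * c)
  have hroot : 2 * c / (b + s) = (b - s) / (2 * a) := by
    rw [div_eq_div_iff (by positivity) (by positivity)]
    linear_combination hsq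
  have hiff : ∀ ξ : ℝ, a * ξ ^ 2 - b * ξ + c = 0 ↔
      ξ = (b + s) / (2 * a) ∨ ξ = (b - s) / (2 * a) := fun ξ => by
    have h := quadratic_eq_zero_iff ha.ne' (b := -b) (c := c) (s := s)
      (by rw [discrim]; linear_combination -hsq) ξ
    rw [neg_neg] at h
    rw [← h]
    ring_nf
  rw [hroot]
  refine ⟨⟨(hiff _).2 (Or.inr rfl), fun ξ hξ => ?_⟩, ?_⟩
  · rcases (hiff ξ).1 hξ with rfl | rfl
    · gcongr
      linarith
    · rfl
  · rw [mul_div_cancel₀ _ (by positivity)]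
    exact sub_lt_self b hs

/-- The bound imposed on `ε` in the perturbation theorem. -/
def epsThreshold (l ζ θ σ : ℝ) : ℝ :=
  l * (1 - σ) ^ 2 / (ζ * (l + l * σ + 2 * θ + 2 * √((l * σ + θ) * (θ + l))))

variable {l ζ θ σ ε : ℝ}

lemma pos_of_lt_epsThreshold (hl : 0 ≤ l) (hζ : 0 ≤ ζ) (hε : 0 ≤ ε)
    (h : ε < epsThreshold l ζ θ σ) : 0 < l ∧ 0 < ζ := by
  have hne := (hε.trans_lt h).ne'
  constructor
  · exact hl.lt_of_ne' fun hl => hne (by simp [epsThreshold, hl])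
  · exact hζ.lt_of_ne' fun hζ => hne (by simp [epsThreshold, hζ])

lemma mul_lt_of_lt_epsThreshold (hl : 0 < l) (hζ : 0 < ζ) (hθ : 0 ≤ θ) (hσ : 0 ≤ σ)
    (h : ε < epsThreshold l ζ θ σ) :
    l * (ζ * ε) < l + l * σ + 2 * θ - 2 * √((l * σ + θ) * (θ + l)) := by
  have hsq : √((l * σ + θ) * (θ + l)) ^ 2 = (l * σ + θ) * (θ + l) := Real.sq_sqrt (by positivity)
  rw [epsThreshold, lt_div_iff₀ (by positivity)] at h
  set R := √((l * σ + θ) * (θ + l))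
  have : 0 ≤ R := Real.sqrt_nonneg _
  have hk : 0 < l + l * σ + 2 * θ + 2 * R := by positivity
  refine lt_of_mul_lt_mul_right ?_ hk.le
  calc l * (ζ * ε) * (l + l * σ + 2 * θ + 2 * R)
      = l * (ε * (ζ * (l + l * σ + 2 * θ + 2 * R))) := by ring
    _ < l * (l * (1 - σ) ^ 2) := by gcongr
    _ = (l + l * σ + 2 * θ - 2 * R) * (l + l * σ + 2 * θ + 2 * R) := by
      linear_combination 4 * hsq

lemma discrim_pos_of_lt_epsThreshold (hl : 0 < l) (hζ : 0 < ζ) (hθ : 0 ≤ θ) (hσ : 0 ≤ σ)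
    (h : ε < epsThreshold l ζ θ σ) :
    0 < (l * (1 + ζ * ε - σ)) ^ 2 - 4 * (ζ * (l + θ)) * (l * ε) := by
  have hlt := mul_lt_of_lt_epsThreshold hl hζ hθ hσ h
  have hsq : √((l * σ + θ) * (θ + l)) ^ 2 = (l * σ + θ) * (θ + l) := Real.sq_sqrt (by positivity)
  have hR : 0 ≤ √((l * σ + θ) * (θ + l)) := Real.sqrt_nonneg _
  set R := √((l * σ + θ) * (θ + l))
  calc 0 < (l + l * σ + 2 * θ - 2 * R - l * (ζ * ε)) *
        (l + l * σ + 2 * θ + 2 * R - l * (ζ * ε)) := mul_pos (by linarith) (by linarith)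
    _ = (l * (1 + ζ * ε - σ)) ^ 2 - 4 * (ζ * (l + θ)) * (l * ε) := by
      linear_combination -4 * hsq

lemma xi3_eq (l ζ θ σ ε : ℝ) :
    xi3 l ζ θ σ ε = 2 * (l * ε) / (l * (1 + ζ * ε - σ) +
      √((l * (1 + ζ * ε - σ)) ^ 2 - 4 * (ζ * (l + θ)) * (l * ε))) := by
  rw [xi3]
  ring_nf

lemma isLeast_xi3_and_two_mul_lt (hl : 0 < l) (hζ : 0 < ζ) (hθ : 0 ≤ θ) (hσ : 0 ≤ σ)
    (hσ₁ : σ < 1) (hε : 0 ≤ ε) (h : ε < epsThreshold l ζ θ σ) :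
    IsLeast {ξ : ℝ | ζ * (l + θ) * ξ ^ 2 - l * (1 + ζ * ε - σ) * ξ + l * ε = 0}
        (xi3 l ζ θ σ ε) ∧
      2 * (ζ * (l + θ)) * xi3 l ζ θ σ ε < l * (1 + ζ * ε - σ) := by
  have hb : 0 < 1 + ζ * ε - σ := by linarith [mul_nonneg hζ.le hε]
  rw [xi3_eq]
  exact isLeast_smaller_root (by positivity) (by positivity)
    (discrim_pos_of_lt_epsThreshold hl hζ hθ hσ h)

lemma xi3_nonneg (hl : 0 < l) (hζ : 0 < ζ) (hσ₁ : σ < 1) (hε : 0 ≤ ε) :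
    0 ≤ xi3 l ζ θ σ ε := by
  have hb : 0 ≤ 1 + ζ * ε - σ := by linarith [mul_nonneg hζ.le hε]
  unfold xi3
  positivity

lemma zeta_mul_xi3_bounds (hl : 0 < l) (hζ : 0 < ζ) (hθ : 0 ≤ θ) (hσ : 0 ≤ σ) (hσ₁ : σ < 1)
    (hε : 0 ≤ ε) (h : ε < epsThreshold l ζ θ σ) :
    ζ * xi3 l ζ θ σ ε < 1 ∧ l * σ + θ < (l + θ) * (1 - ζ * xi3 l ζ θ σ ε) ^ 2 := by
  obtain ⟨⟨hroot, -⟩, hlt⟩ := isLeast_xi3_and_two_mul_lt hl hζ hθ hσ hσ₁ hε h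
  have hpos := mul_lt_of_lt_epsThreshold hl hζ hθ hσ h
  have hR : 0 ≤ √((l * σ + θ) * (θ + l)) := Real.sqrt_nonneg _
  rw [Set.mem_ofPred_eq] at hroot
  set ξ := xi3 l ζ θ σ ε
  have hu : l + l * σ + 2 * θ - l * (ζ * ε) < 2 * (l + θ) * (1 - ζ * ξ) := by linarith
  have hu₀ : 0 < 1 - ζ * ξ :=
    (mul_pos_iff_of_pos_left (show 0 < 2 * (l + θ) by positivity)).1 (by linarith)
  refine ⟨sub_pos.1 hu₀, ?_⟩
  calc l * σ + θ = (l + l * σ + 2 * θ - l * (ζ * ε)) * (1 - ζ * ξ)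
        - (l + θ) * (1 - ζ * ξ) ^ 2 := by linear_combination ζ * hroot
    _ < 2 * (l + θ) * (1 - ζ * ξ) * (1 - ζ * ξ) - (l + θ) * (1 - ζ * ξ) ^ 2 := by gcongr
    _ = (l + θ) * (1 - ζ * ξ) ^ 2 := by ring

end Scalar

section Perturbation

variable {m n : ℕ} {A : Fin m → Mat n} {Q X X' : Mat n}

lemma exists_fixedPoint_of_lipschitzOnWith {E : Type*} [MetricSpace E] {s : Set E}
    (hs : IsComplete s) (hne : s.Nonempty) {f : E → E} (hf : Set.MapsTo f s s) {K : NNReal}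
    (hK : K < 1) (hlip : LipschitzOnWith K f s) : ∃ x ∈ s, f x = x := by
  obtain ⟨x₀, hx₀⟩ := hne
  obtain ⟨x, hx, hfix, -⟩ := ContractingWith.exists_fixedPoint' hs hf
    ⟨hK, hlip.mapsToRestrict hf⟩ hx₀ (edist_ne_top _ _)
  exact ⟨x, hx, hfix⟩

/-- The map whose fixed points `H` are the perturbations of the solution. -/
def perturbationMap (A : Fin m → Mat n) {X : Mat n} (hX : X.IsHermitian) (D : Fin m → Mat n)
    (ΔQ H : Herm n) : Herm n :=
  Linv A X (ΔQ + ∑ i, S A X i (D i) + remainder A hX D H)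

lemma perturbationMap_eq_iff (hL : (L A X).IsInvertible) (hX : IsPosDefSolution A Q X)
    (D : Fin m → Mat n) (ΔQ H : Herm n) :
    perturbationMap A hX.1.isHermitian D ΔQ H = H ↔
      X + (H : Mat n) - ∑ i, (A i + D i)ᴴ * (X + (H : Mat n))⁻¹ * (A i + D i) = Q + ΔQ := by
  rw [perturbed_equation_iff hX, perturbationMap, Linv, hL.inverse_apply_eq, eq_comm]

lemma norm_Linv_firstOrder_le (A : Fin m → Mat n) (X : Mat n) (D : Fin m → Mat n)
    (ΔQ : Herm n) :
    ‖Linv A X ΔQ + Linv A X (∑ i, S A X i (D i))‖ ≤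
      1 / ell A X * ‖ΔQ‖ + ∑ i, ‖P A X i‖ * ‖D i‖ := by
  refine norm_add_le_of_le ?_ ?_
  · rw [ell, one_div, inv_inv]
    exact (Linv A X).le_opNorm ΔQ
  · rw [map_sum]
    exact norm_sum_le_of_le _ fun i _ => (P A X i).le_opNorm (D i)

lemma eps_eq (A : Fin m → Mat n) (X : Mat n) (D : Fin m → Mat n) (ΔQ : Herm n) :
    eps A X D ΔQ = 1 / ell A X * ‖ΔQ‖ + ∑ i, ‖P A X i‖ * ‖D i‖ +
      ‖Linv A X‖ * ∑ i, zeta X * ‖D i‖ ^ 2 := by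
  simp only [eps, ell, div_inv_eq_mul, Finset.sum_add_distrib, Finset.mul_sum, add_assoc]
  congr 2
  exact Finset.sum_congr rfl fun i _ => by ring

lemma sigma_eq (A : Fin m → Mat n) (X : Mat n) (D : Fin m → Mat n) :
    sigma A X D = ‖Linv A X‖ * tau A X D := by
  rw [sigma, tau, ell, div_inv_eq_mul]
  ring

lemma sigma_nonneg (A : Fin m → Mat n) (X : Mat n) (D : Fin m → Mat n) : 0 ≤ sigma A X D := by
  rw [sigma_eq]
  exact mul_nonneg (Linv A X).opNorm_nonneg (tau_nonneg A X D)

lemma eps_nonneg (A : Fin m → Mat n) (X : Mat n) (D : Fin m → Mat n) (ΔQ : Herm n) :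
    0 ≤ eps A X D ΔQ := by
  have := zeta_nonneg X
  rw [eps_eq]
  exact add_nonneg ((norm_nonneg _).trans (norm_Linv_firstOrder_le A X D ΔQ))
    (mul_nonneg (Linv A X).opNorm_nonneg (Finset.sum_nonneg fun _ _ => by positivity))

lemma norm_perturbationMap_le (A : Fin m → Mat n) (hX : X.PosDef) (D : Fin m → Mat n)
    (ΔQ : Herm n) {H : Herm n} {x : ℝ} (hHx : ‖H‖ ≤ x) (hx : zeta X * x < 1) :
    ‖perturbationMap A hX.isHermitian D ΔQ H‖ ≤
      eps A X D ΔQ + ‖Linv A X‖ * (remainderLip A X D (neumannBound X x) * x) := by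
  rw [perturbationMap, map_add, map_add, eps_eq, add_assoc _ (‖Linv A X‖ * _), ← mul_add]
  exact norm_add_le_of_le (norm_Linv_firstOrder_le A X D ΔQ)
    ((Linv A X).le_opNorm_of_le (norm_remainder_le A hX D hHx hx))

lemma lipschitzOnWith_perturbationMap (A : Fin m → Mat n) (hX : X.PosDef) (D : Fin m → Mat n)
    (ΔQ : Herm n) {x : ℝ} (hx : zeta X * x < 1) :
    LipschitzOnWith (‖Linv A X‖ * remainderLip A X D (neumannBound X x ^ 2)).toNNReal
      (perturbationMap A hX.isHermitian D ΔQ) (Metric.closedBall 0 x) := by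
  refine LipschitzOnWith.of_dist_le_mul fun H hH K hK => ?_
  rw [mem_closedBall_zero_iff] at hH hK
  have hrem := norm_remainder_sub_le A hX D hH hx hK hx
  rw [← sq] at hrem
  calc dist (perturbationMap A hX.isHermitian D ΔQ H) (perturbationMap A hX.isHermitian D ΔQ K)
      = ‖Linv A X (remainder A hX.isHermitian D H - remainder A hX.isHermitian D K)‖ := by
        rw [dist_eq_norm, perturbationMap, perturbationMap, ← map_sub, add_sub_add_left_eq_sub]
    _ ≤ ‖Linv A X‖ * remainderLip A X D (neumannBound X x ^ 2) * ‖H - K‖ :=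
        ((Linv A X).le_opNorm_of_le hrem).trans_eq (mul_assoc _ _ _).symm
    _ ≤ _ := by
        rw [dist_eq_norm H K]
        gcongr
        exact Real.le_coe_toNNReal _

lemma exists_isPosDefSolution (hL : (L A X).IsInvertible) (hX : IsPosDefSolution A Q X)
    (D : Fin m → Mat n) (ΔQ : Herm n) {ξ : ℝ} (hξ₀ : 0 ≤ ξ) (hξ : zeta X * ξ < 1)
    (hself : eps A X D ΔQ + ‖Linv A X‖ * (remainderLip A X D (neumannBound X ξ) * ξ) ≤ ξ)
    (hcontr : ‖Linv A X‖ * remainderLip A X D (neumannBound X ξ ^ 2) < 1) :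
    ∃ H : Herm n, ‖H‖ ≤ ξ ∧
      IsPosDefSolution (fun i => A i + D i) (Q + (ΔQ : Mat n)) (X + (H : Mat n)) := by
  obtain ⟨H, hH, hfix⟩ := exists_fixedPoint_of_lipschitzOnWith
    (Metric.isClosed_closedBall.isComplete) ⟨0, Metric.mem_closedBall_self hξ₀⟩
    (f := perturbationMap A hX.1.isHermitian D ΔQ)
    (fun H hH => by
      rw [mem_closedBall_zero_iff] at hH ⊢
      exact (norm_perturbationMap_le A hX.1 D ΔQ hH hξ).trans hself)
    (Real.toNNReal_lt_one.2 hcontr) (lipschitzOnWith_perturbationMap A hX.1 D ΔQ hξ)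
  rw [mem_closedBall_zero_iff] at hH
  refine ⟨H, hH, posDef_add_of_norm_lt hX.1 H.2 ?_, (perturbationMap_eq_iff hL hX D ΔQ H).1 hfix⟩
  exact (mul_le_mul_of_nonneg_left hH (zeta_nonneg X)).trans_lt hξ

lemma norm_sub_le_of_contraction (hL : (L A X).IsInvertible) (hX : IsPosDefSolution A Q X)
    {D : Fin m → Mat n} {ΔQ : Herm n} (hQ' : (Q + (ΔQ : Mat n)).PosDef)
    (hX' : IsPosDefSolution (fun i => A i + D i) (Q + (ΔQ : Mat n)) X')
    {ξ : ℝ} (hξ₀ : 0 ≤ ξ) (hξ : zeta X * ξ < 1)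
    (hself : eps A X D ΔQ + ‖Linv A X‖ * (remainderLip A X D (neumannBound X ξ) * ξ) ≤ ξ)
    (hcontr : ‖Linv A X‖ * remainderLip A X D (neumannBound X ξ ^ 2) < 1) :
    ‖X' - X‖ ≤ ξ := by
  obtain ⟨H, hH, hsol⟩ := exists_isPosDefSolution hL hX D ΔQ hξ₀ hξ hself hcontr
  rwa [hX'.unique hQ' hsol, add_sub_cancel_left]

lemma norm_Linv_mul_eq_iff (hl : 0 < ell A X) {a b : ℝ} :
    ‖Linv A X‖ * a = b ↔ a = ell A X * b := by
  rw [← inv_inv ‖Linv A X‖, ← ell, inv_mul_eq_iff_eq_mul₀ hl.ne']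

lemma tau_eq_ell_mul_sigma (hl : 0 < ell A X) (D : Fin m → Mat n) :
    tau A X D = ell A X * sigma A X D :=
  (norm_Linv_mul_eq_iff hl).1 (sigma_eq A X D).symm

lemma eps_add_remainderLip_mul_eq {D : Fin m → Mat n} {ΔQ : Herm n} {ξ : ℝ}
    (hl : 0 < ell A X) (hξ : zeta X * ξ < 1)
    (hroot : zeta X * (ell A X + theta A X) * ξ ^ 2
      - ell A X * (1 + zeta X * eps A X D ΔQ - sigma A X D) * ξ + ell A X * eps A X D ΔQ = 0) :
    eps A X D ΔQ + ‖Linv A X‖ * (remainderLip A X D (neumannBound X ξ) * ξ) = ξ := by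
  have hr : neumannBound X ξ * (1 - zeta X * ξ) = 1 := inv_mul_cancel₀ (sub_pos.2 hξ).ne'
  rw [add_comm, ← eq_sub_iff_add_eq, norm_Linv_mul_eq_iff hl, remainderLip,
    tau_eq_ell_mul_sigma hl]
  linear_combination neumannBound X ξ * hroot +
    ((ell A X + theta A X) * ξ - ell A X * eps A X D ΔQ) * hr

lemma norm_Linv_mul_remainderLip_sq_lt_one {D : Fin m → Mat n} {ξ : ℝ}
    (hl : 0 < ell A X) (hξ : zeta X * ξ < 1)
    (h : ell A X * sigma A X D + theta A X < (ell A X + theta A X) * (1 - zeta X * ξ) ^ 2) :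
    ‖Linv A X‖ * remainderLip A X D (neumannBound X ξ ^ 2) < 1 := by
  have hu : 0 < (1 - zeta X * ξ) ^ 2 := pow_pos (sub_pos.2 hξ) 2
  rw [← inv_inv ‖Linv A X‖, ← ell, inv_mul_lt_iff₀ hl, mul_one, remainderLip,
    tau_eq_ell_mul_sigma hl]
  have hdiv := (div_lt_iff₀ hu).2 h
  rw [div_eq_mul_inv, ← inv_pow, ← neumannBound] at hdiv
  linarith

theorem norm_sub_le_xi3_and_isLeast (hL : (L A X).IsInvertible) (hX : IsPosDefSolution A Q X)
    {D : Fin m → Mat n} {ΔQ : Herm n} (hQ' : (Q + (ΔQ : Mat n)).PosDef)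
    (hX' : IsPosDefSolution (fun i => A i + D i) (Q + (ΔQ : Mat n)) X')
    (hσ₁ : sigma A X D < 1)
    (h : eps A X D ΔQ < epsThreshold (ell A X) (zeta X) (theta A X) (sigma A X D)) :
    ‖X' - X‖ ≤ xi3 (ell A X) (zeta X) (theta A X) (sigma A X D) (eps A X D ΔQ) ∧
      IsLeast {ξ : ℝ | zeta X * (ell A X + theta A X) * ξ ^ 2
          - ell A X * (1 + zeta X * eps A X D ΔQ - sigma A X D) * ξ
          + ell A X * eps A X D ΔQ = 0}
        (xi3 (ell A X) (zeta X) (theta A X) (sigma A X D) (eps A X D ΔQ)) := by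
  have hε := eps_nonneg A X D ΔQ
  have hθ := theta_nonneg A X
  have hσ := sigma_nonneg A X D
  obtain ⟨hl, hζ⟩ := pos_of_lt_epsThreshold (inv_nonneg.2 (Linv A X).opNorm_nonneg)
    (zeta_nonneg X) hε h
  have hleast := (isLeast_xi3_and_two_mul_lt hl hζ hθ hσ hσ₁ hε h).1
  obtain ⟨hξ, hcontr⟩ := zeta_mul_xi3_bounds hl hζ hθ hσ hσ₁ hε h
  exact ⟨norm_sub_le_of_contraction hL hX hQ' hX' (xi3_nonneg hl hζ hσ₁ hε) hξ
    (eps_add_remainderLip_mul_eq hl hξ hleast.1).le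
    (norm_Linv_mul_remainderLip_sq_lt_one hl hξ hcontr), hleast⟩

end Perturbation

section Asymptotics

variable {m n : ℕ} {A : Fin m → Mat n} {Q X X' : Mat n}

lemma norm_le_sqrt_sum_sq {𝕜 ι κ : Type*} [RCLike 𝕜] [Fintype ι] [Fintype κ] [DecidableEq κ]
    (M : Matrix ι κ 𝕜) : ‖M‖ ≤ √(∑ i, ∑ j, ‖M i j‖ ^ 2) := by
  rw [Matrix.l2_opNorm_def]
  refine ContinuousLinearMap.opNorm_le_bound _ (Real.sqrt_nonneg _) fun x => ?_
  rw [EuclideanSpace.norm_eq, EuclideanSpace.norm_eq, ← Real.sqrt_mul (by positivity),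
    Finset.sum_mul]
  refine Real.sqrt_le_sqrt (Finset.sum_le_sum fun i _ => ?_)
  calc ‖∑ j, M i j * x j‖ ^ 2 ≤ (∑ j, ‖M i j‖ * ‖x j‖) ^ 2 := by
        gcongr
        exact norm_sum_le_of_le _ fun j _ => norm_mul_le _ _
    _ ≤ (∑ j, ‖M i j‖ ^ 2) * ∑ j, ‖x j‖ ^ 2 := Finset.sum_mul_sq_le_sq_mul_sq _ _ _

lemma norm_le_pertNorm_left (D : Fin m → Mat n) (ΔQ : Herm n) (k : Fin m) :
    ‖D k‖ ≤ pertNorm D ΔQ := by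
  refine (norm_le_sqrt_sum_sq _).trans (Real.sqrt_le_sqrt ?_)
  have hk := Finset.single_le_sum (f := fun k => ∑ i, ∑ j, ‖D k i j‖ ^ 2)
    (fun _ _ => by positivity) (Finset.mem_univ k)
  exact hk.trans (le_add_of_nonneg_right (by positivity))

lemma norm_le_pertNorm_right (D : Fin m → Mat n) (ΔQ : Herm n) : ‖ΔQ‖ ≤ pertNorm D ΔQ :=
  (norm_le_sqrt_sum_sq _).trans
    (Real.sqrt_le_sqrt (le_add_of_nonneg_left (by positivity)))

lemma norm_sub_le_of_expansion {D : Fin m → Mat n} {ΔQ : Herm n} {c : ℝ}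
    (h : ‖(X' - X) - ((Linv A X ΔQ : Herm n) : Mat n)
      - ((Linv A X (∑ i, S A X i (D i)) : Herm n) : Mat n)‖ ≤ c) :
    ‖X' - X‖ ≤ 1 / ell A X * ‖ΔQ‖ + ∑ i, ‖P A X i‖ * ‖D i‖ + c := by
  rw [sub_sub] at h
  exact (norm_le_norm_add_norm_sub' _ _).trans
    (add_le_add (norm_Linv_firstOrder_le A X D ΔQ) h)

lemma norm_sub_firstOrder_le (hL : (L A X).IsInvertible) (hX : IsPosDefSolution A Q X)
    {D : Fin m → Mat n} {ΔQ : Herm n}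
    (hX' : IsPosDefSolution (fun i => A i + D i) (Q + (ΔQ : Mat n)) X') {x : ℝ}
    (hx : ‖X' - X‖ ≤ x) (hζx : zeta X * x < 1) :
    ‖(X' - X) - ((Linv A X ΔQ : Herm n) : Mat n)
        - ((Linv A X (∑ i, S A X i (D i)) : Herm n) : Mat n)‖ ≤
      ‖Linv A X‖ *
        (∑ i, zeta X * ‖D i‖ ^ 2 + remainderLip A X D (neumannBound X x) * x) := by
  let H : Herm n := ⟨X' - X, hX'.1.isHermitian.sub hX.1.isHermitian⟩
  have hXH : X + (H : Mat n) = X' := add_sub_cancel _ _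
  have hfix : perturbationMap A hX.1.isHermitian D ΔQ H = H := by
    rw [perturbationMap_eq_iff hL hX, hXH]
    exact hX'.2
  have hdiff : H - Linv A X ΔQ - Linv A X (∑ i, S A X i (D i)) =
      Linv A X (remainder A hX.1.isHermitian D H) := by
    rw [perturbationMap, map_add, map_add] at hfix
    rw [sub_sub, sub_eq_iff_eq_add', hfix]
  have hrem := (Linv A X).le_opNorm_of_le (norm_remainder_le A hX.1 D (H := H) hx hζx)
  rwa [← hdiff] at hrem

lemma sum_zeta_mul_sq_le (X : Mat n) {D : Fin m → Mat n} {p : ℝ} (hD : ∀ i, ‖D i‖ ≤ p) :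
    ∑ i, zeta X * ‖D i‖ ^ 2 ≤ m * zeta X * p ^ 2 := by
  have := zeta_nonneg X
  calc ∑ i, zeta X * ‖D i‖ ^ 2 ≤ ∑ _i : Fin m, zeta X * p ^ 2 := by
        gcongr with i
        exact hD i
    _ = m * zeta X * p ^ 2 := by simp [mul_assoc]

lemma exists_eps_le_mul (A : Fin m → Mat n) (X : Mat n) :
    ∃ c : ℝ, 0 ≤ c ∧ ∀ (D : Fin m → Mat n) (ΔQ : Herm n) (p : ℝ), 0 ≤ p → p ≤ 1 →
      (∀ i, ‖D i‖ ≤ p) → ‖ΔQ‖ ≤ p → eps A X D ΔQ ≤ c * p := by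
  have hζ := zeta_nonneg X
  have hΛ := (Linv A X).opNorm_nonneg
  refine ⟨‖Linv A X‖ + ∑ i, ‖P A X i‖ + ‖Linv A X‖ * (m * zeta X),
    add_nonneg (add_nonneg hΛ (Finset.sum_nonneg fun i _ => (P A X i).opNorm_nonneg))
      (by positivity),
    fun D ΔQ p hp₀ hp₁ hD hΔQ => ?_⟩
  have hquad : ∑ i, zeta X * ‖D i‖ ^ 2 ≤ m * zeta X * p :=
    (sum_zeta_mul_sq_le X hD).trans (by gcongr; exact pow_le_of_le_one hp₀ hp₁ two_ne_zero)
  rw [eps_eq, ell, one_div, inv_inv, add_mul, add_mul, Finset.sum_mul, mul_assoc ‖Linv A X‖]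
  gcongr with i
  exact hD i

lemma exists_tau_le_mul (A : Fin m → Mat n) (X : Mat n) :
    ∃ c : ℝ, ∀ (D : Fin m → Mat n) (p : ℝ), p ≤ 1 → (∀ i, ‖D i‖ ≤ p) →
      tau A X D ≤ c * p := by
  have hζ := zeta_nonneg X
  refine ⟨zeta X * ∑ i, ((‖A i‖ + 1) * zeta X + ‖B A X i‖), fun D p hp₁ hD => ?_⟩
  rw [tau, mul_assoc, Finset.sum_mul]
  gcongr with i
  · exact (hD i).trans hp₁
  · exact hD i

lemma neumannBound_le_one_add {x : ℝ} (hx₀ : 0 ≤ x) (hx : zeta X * x ≤ 1 / 2) :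
    neumannBound X x ≤ 1 + 2 * (zeta X * x) := by
  have hζx := mul_nonneg (zeta_nonneg X) hx₀
  rw [neumannBound, inv_le_iff_one_le_mul₀ (by linarith)]
  nlinarith

lemma remainderLip_neumannBound_sq_le (A D : Fin m → Mat n) {x : ℝ}
    (hx₀ : 0 ≤ x) (hx : zeta X * x ≤ 1 / 2) :
    remainderLip A X D (neumannBound X x ^ 2) ≤
      6 * theta A X * zeta X * x + 4 * tau A X D := by
  have hθ := theta_nonneg A X
  have hτ := tau_nonneg A X D
  have hr := neumannBound_le_one_add hx₀ hx
  have hr₁ := one_le_neumannBound hx₀ (hx.trans_lt one_half_lt_one)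
  have hr₂ : neumannBound X x ≤ 2 := by linarith
  calc remainderLip A X D (neumannBound X x ^ 2)
      = theta A X * ((neumannBound X x - 1) * (neumannBound X x + 1)) +
          neumannBound X x ^ 2 * tau A X D := by rw [remainderLip]; ring
    _ ≤ theta A X * (2 * (zeta X * x) * (2 + 1)) + 2 ^ 2 * tau A X D := by
      gcongr <;> linarith
    _ = 6 * theta A X * zeta X * x + 4 * tau A X D := by ring

lemma remainderLip_mono (A : Fin m → Mat n) (X : Mat n) (D : Fin m → Mat n) :
    Monotone (remainderLip A X D) := fun ρ ρ' h => by
  have := theta_nonneg A X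
  have := tau_nonneg A X D
  unfold remainderLip
  gcongr

lemma remainderLip_neumannBound_le_sq (A D : Fin m → Mat n) {x : ℝ}
    (hx₀ : 0 ≤ x) (hx : zeta X * x < 1) :
    remainderLip A X D (neumannBound X x) ≤ remainderLip A X D (neumannBound X x ^ 2) :=
  remainderLip_mono A X D (le_self_pow₀ (one_le_neumannBound hx₀ hx) two_ne_zero)

lemma exists_remainderLip_le_mul (A : Fin m → Mat n) (X : Mat n) {c : ℝ} (hc : 0 ≤ c) :
    ∃ K : ℝ, ∀ (D : Fin m → Mat n) (p : ℝ), 0 ≤ p → p ≤ 1 → (∀ i, ‖D i‖ ≤ p) →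
      zeta X * (c * p) ≤ 1 / 2 → remainderLip A X D (neumannBound X (c * p) ^ 2) ≤ K * p := by
  obtain ⟨c₂, hτ⟩ := exists_tau_le_mul A X
  refine ⟨6 * theta A X * zeta X * c + 4 * c₂, fun D p hp₀ hp₁ hD hcp => ?_⟩
  linarith [remainderLip_neumannBound_sq_le A D (mul_nonneg hc hp₀) hcp, hτ D p hp₁ hD]

lemma eventually_const_mul_lt (k : ℝ) {e : ℝ} (he : 0 < e) :
    ∀ᶠ p in nhds (0 : ℝ), k * p < e :=
  (continuous_const_mul k).tendsto' 0 0 (mul_zero k) |>.eventually_lt_const he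

lemma exists_norm_sub_le_mul (hQ : Q.PosDef) (hX : IsPosDefSolution A Q X) :
    ∃ c : ℝ, 0 ≤ c ∧ ∀ᶠ p in nhds (0 : ℝ), ∀ (D : Fin m → Mat n) (ΔQ : Herm n) (X' : Mat n),
      IsPosDefSolution (fun i => A i + D i) (Q + (ΔQ : Mat n)) X' →
      (∀ i, ‖D i‖ ≤ p) → ‖ΔQ‖ ≤ p → ‖X' - X‖ ≤ c * p := by
  have hΛ := (Linv A X).opNorm_nonneg
  obtain ⟨c, hc, hε⟩ := exists_eps_le_mul A X
  obtain ⟨K, hK⟩ := exists_remainderLip_le_mul A X (mul_nonneg zero_le_two hc)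
  refine ⟨2 * c, by positivity, ?_⟩
  filter_upwards [eventually_le_nhds one_pos, eventually_const_mul_lt ‖Q⁻¹‖ one_pos,
    eventually_const_mul_lt (zeta X * (2 * c)) one_half_pos,
    eventually_const_mul_lt (‖Linv A X‖ * K) one_half_pos]
    with p hp₁ hQp hζp hKp D ΔQ X' hX' hD hΔQ
  have hp₀ : 0 ≤ p := (norm_nonneg _).trans hΔQ
  have hξ₀ : 0 ≤ 2 * c * p := by positivity
  rw [mul_assoc] at hζp hKp
  have hξ := hζp.trans one_half_lt_one
  have hQ' : (Q + (ΔQ : Mat n)).PosDef := posDef_add_of_norm_lt hQ ΔQ.2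
    ((mul_le_mul_of_nonneg_left hΔQ (norm_nonneg _)).trans_lt hQp)
  have hcontr : ‖Linv A X‖ * remainderLip A X D (neumannBound X (2 * c * p) ^ 2) ≤ 1 / 2 :=
    (mul_le_mul_of_nonneg_left (hK D p hp₀ hp₁ hD hζp.le) hΛ).trans hKp.le
  refine norm_sub_le_of_contraction (hX.isInvertible_L hQ) hX hQ' hX' hξ₀ hξ ?_
    (hcontr.trans_lt one_half_lt_one)
  rw [← mul_assoc ‖Linv A X‖]
  calc eps A X D ΔQ +
        ‖Linv A X‖ * remainderLip A X D (neumannBound X (2 * c * p)) * (2 * c * p)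
      ≤ c * p + 1 / 2 * (2 * c * p) := by
        gcongr
        · exact hε D ΔQ p hp₀ hp₁ hD hΔQ
        · exact (mul_le_mul_of_nonneg_left (remainderLip_neumannBound_le_sq A D hξ₀ hξ)
            hΛ).trans hcontr
    _ = 2 * c * p := by ring

theorem exists_norm_sub_firstOrder_le_mul_sq (hQ : Q.PosDef) (hX : IsPosDefSolution A Q X) :
    ∃ C δ : ℝ, 0 < δ ∧ ∀ (D : Fin m → Mat n) (ΔQ : Herm n) (X' : Mat n),
      IsPosDefSolution (fun i => A i + D i) (Q + (ΔQ : Mat n)) X' → pertNorm D ΔQ < δ →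
      ‖(X' - X) - ((Linv A X ΔQ : Herm n) : Mat n)
        - ((Linv A X (∑ i, S A X i (D i)) : Herm n) : Mat n)‖ ≤ C * pertNorm D ΔQ ^ 2 := by
  have := (Linv A X).opNorm_nonneg
  obtain ⟨c, hc, hbound⟩ := exists_norm_sub_le_mul hQ hX
  obtain ⟨K, hK⟩ := exists_remainderLip_le_mul A X hc
  obtain ⟨δ, hδ, hsmall⟩ := Metric.eventually_nhds_iff.1 <| hbound.and <|
    (eventually_le_nhds one_pos).and (eventually_const_mul_lt (zeta X * c) one_half_pos)
  refine ⟨‖Linv A X‖ * (m * zeta X + K * c), δ, hδ, fun D ΔQ X' hX' hp => ?_⟩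
  have hD := norm_le_pertNorm_left D ΔQ
  have hΔQ := norm_le_pertNorm_right D ΔQ
  have hp₀ : 0 ≤ pertNorm D ΔQ := Real.sqrt_nonneg _
  set p := pertNorm D ΔQ
  obtain ⟨hsub, hp₁, hζp⟩ := hsmall (y := p) (by rwa [Real.dist_0_eq_abs, abs_of_nonneg hp₀])
  rw [mul_assoc] at hζp
  have hx₀ : 0 ≤ c * p := by positivity
  have hx := hζp.trans one_half_lt_one
  have hlip := (remainderLip_neumannBound_le_sq A D hx₀ hx).trans (hK D p hp₀ hp₁ hD hζp.le)
  calc _ ≤ ‖Linv A X‖ *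
        (∑ i, zeta X * ‖D i‖ ^ 2 + remainderLip A X D (neumannBound X (c * p)) * (c * p)) :=
      norm_sub_firstOrder_le (hX.isInvertible_L hQ) hX hX' (hsub D ΔQ X' hX' hD hΔQ) hx
    _ ≤ ‖Linv A X‖ * (m * zeta X * p ^ 2 + K * p * (c * p)) := by
      gcongr
      exact sum_zeta_mul_sq_le X hD
    _ = ‖Linv A X‖ * (m * zeta X + K * c) * p ^ 2 := by ring

end Asymptotics

end MatrixEq

end

theorem theorem4p4 {m n : ℕ} (A : Fin m → MatrixEq.Mat n) (Q X : MatrixEq.Mat n)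
    (hQ : Q.PosDef) (hX : MatrixEq.IsPosDefSolution A Q X) :
    -- `L` is invertible
    (MatrixEq.L A X).IsInvertible ∧
    -- the perturbation bound
    (∀ (ΔA : Fin m → MatrixEq.Mat n) (ΔQ : MatrixEq.Herm n) (X' : MatrixEq.Mat n),
      (Q + (ΔQ : MatrixEq.Mat n)).PosDef →
      MatrixEq.IsPosDefSolution (fun i => A i + ΔA i) (Q + (ΔQ : MatrixEq.Mat n)) X' →
      ∀ l ζ θ σ ε : ℝ,
        l = MatrixEq.ell A X → ζ = MatrixEq.zeta X → θ = MatrixEq.theta A X →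
        σ = MatrixEq.sigma A X ΔA → ε = MatrixEq.eps A X ΔA ΔQ →
        σ < 1 →
        ε < l * (1 - σ) ^ 2 /
          (ζ * (l + l * σ + 2 * θ + 2 * √((l * σ + θ) * (θ + l)))) →
        ‖X' - X‖ ≤ MatrixEq.xi3 l ζ θ σ ε ∧
        IsLeast {ξ : ℝ | ζ * (l + θ) * ξ ^ 2 - l * (1 + ζ * ε - σ) * ξ + l * ε = 0}
          (MatrixEq.xi3 l ζ θ σ ε)) ∧
    -- the first order bound and the first order expansion as the perturbation tends to zero
    (∃ C δ : ℝ, 0 < δ ∧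
      ∀ (ΔA : Fin m → MatrixEq.Mat n) (ΔQ : MatrixEq.Herm n) (X' : MatrixEq.Mat n),
        MatrixEq.IsPosDefSolution (fun i => A i + ΔA i) (Q + (ΔQ : MatrixEq.Mat n)) X' →
        MatrixEq.pertNorm ΔA ΔQ < δ →
        ‖X' - X‖ ≤ 1 / MatrixEq.ell A X * ‖ΔQ‖ + ∑ i, ‖MatrixEq.P A X i‖ * ‖ΔA i‖
            + C * MatrixEq.pertNorm ΔA ΔQ ^ 2 ∧
        ‖(X' - X) - ((MatrixEq.Linv A X ΔQ : MatrixEq.Herm n) : MatrixEq.Mat n)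
            - ((MatrixEq.Linv A X (∑ i, MatrixEq.S A X i (ΔA i)) : MatrixEq.Herm n) :
                MatrixEq.Mat n)‖
          ≤ C * MatrixEq.pertNorm ΔA ΔQ ^ 2) := by
  refine ⟨hX.isInvertible_L hQ, ?_, ?_⟩
  · rintro ΔA ΔQ X' hQ' hX' _ _ _ _ _ rfl rfl rfl rfl rfl hσ hε
    exact MatrixEq.norm_sub_le_xi3_and_isLeast (hX.isInvertible_L hQ) hX hQ' hX' hσ hε
  · obtain ⟨C, δ, hδ, hexp⟩ := MatrixEq.exists_norm_sub_firstOrder_le_mul_sq hQ hX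
    refine ⟨C, δ, hδ, fun ΔA ΔQ X' hX' hp => ?_⟩
    have hfirst := hexp ΔA ΔQ X' hX' hp
    exact ⟨MatrixEq.norm_sub_le_of_expansion hfirst, hfirst⟩
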